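/- **Setting.** *Objects* are truth values (true, false), individuals, and sets of objects. A language consists of a set $V$ of variables, a set $\mathcal C$ of constants $c$ with meaning an object $\#(c)$, and a set $\mathcal F$ of operators $f$, each with an applicability condition $A_f(a_1,\dots,a_n)$ and, where it holds, a value $P_f(a_1,\dots,a_n)$. Among the operators are: $\to$, applicable exactly to two truth values, with $P_\to(a,b)$ true iff $a$ is false or $b$ is true; $\forall$, applicable exactly to one argument which is a set of truth values, with $P_\forall(a)$ true iff every member of $a$ is true; and $=$, applicable exactly to two arguments, with $P_=(a,b)$ true iff $a=b$. A *context* is a finite sequence $k=(x_1,\varphi_1)\,\|\,\dots\,\|\,(x_m,\varphi_m)$ of pairs of a variable and an expression, $\varepsilon$ is the empty context, and $\operatorname{dom}(k)=\{x_1,\dots,x_m\}$. The sets $E(k)$ of expressions of the context $k$, the sets $\Xi(k)$ of states on $k$ and the meaning $\#(k,t,\sigma)$ of $t\in E(k)$ in $\sigma\in\Xi(k)$ are defined together. First, $\Xi(\varepsilon)=\{\varepsilon\}$ and $\Xi(h\,\|\,(y,\varphi))=\{\rho\,\|\,(y,s):\rho\in\Xi(h),\ s\in\#(h,\varphi,\rho)\}$.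 For $\sigma=(x_1,s_1)\,\|\,\dots\,\|\,(x_m,s_m)$ put $\sigma(x_i)=s_i$. The expressions are those obtained by finitely many applications of the following rules. 1. $c\in E(\varepsilon)$ for every constant $c$, with meaning $\#(c)$. 2. Let $\varphi\in E(h)$ with $\#(h,\varphi,\rho)$ a set for all $\rho\in\Xi(h)$, let $y\in V\setminus\operatorname{dom}(h)$ and $k=h\,\|\,(y,\varphi)$. Then $y\in E(k)$ with $\#(k,y,\sigma)=\sigma(y)$; and every $t\in E(h)$ with $y\notin V_b(t)$ is in $E(k)$, with $\#(k,t,\rho\,\|\,(y,s))=\#(h,t,\rho)$. 3. If $m\ge1$, $\varphi,\varphi_1,\dots,\varphi_m\in E(k)$ and, for all $\sigma\in\Xi(k)$, $\#(k,\varphi,\sigma)$ is a function with $m$ arguments whose domain contains $(\#(k,\varphi_1,\sigma),\dots,\#(k,\varphi_m,\sigma))$, then $(\varphi)(\varphi_1,\dots,\varphi_m)\in E(k)$, and its meaning is the value of that function at that tuple. 4. If $m\ge1$, $f\in\mathcal F$, $\varphi_1,\dots,\varphi_m\in E(k)$ and $A_f(\#(k,\varphi_1,\sigma),\dots,\#(k,\varphi_m,\sigma))$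 for all $\sigma\in\Xi(k)$, then $(f)(\varphi_1,\dots,\varphi_m)\in E(k)$, and its meaning is $P_f(\#(k,\varphi_1,\sigma),\dots,\#(k,\varphi_m,\sigma))$. 5. Let $m\ge1$, let $x_1,\dots,x_m\in V\setminus\operatorname{dom}(k)$ be distinct, and put $k'_i=k\,\|\,(x_1,\varphi_1)\,\|\,\dots\,\|\,(x_i,\varphi_i)$. If, for $i=1,\dots,m$, $\varphi_i\in E(k'_{i-1})$ and $\#(k'_{i-1},\varphi_i,\sigma)$ is a set for all $\sigma\in\Xi(k'_{i-1})$, and if $\varphi\in E(k'_m)$, then $\{\}(x_1:\varphi_1,\dots,x_m:\varphi_m,\varphi)\in E(k)$, and its meaning in $\sigma$ is the set of all $\#(k'_m,\varphi,\sigma')$ with $\sigma'\in\Xi(k'_m)$ extending $\sigma$. $V_b(t)$ is the set of the variables that occur bound in $t$, that is, as one of $x_1,\dots,x_m$ in a part $\{\}(x_1:\varphi_1,\dots,x_m:\varphi_m,\varphi)$ of $t$. $S(k)$ is the set of all $t\in E(k)$ such that $\#(k,t,\sigma)$ is a truth value for every $\sigma\in\Xi(k)$. For $t\in E(\varepsilon)$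 write $\#(t)$ for $\#(\varepsilon,t,\varepsilon)$; for $t\in S(\varepsilon)$, "$\#(t)$ holds" means that $\#(t)$ is true. $\varphi\{x/t\}$ is the expression obtained from $\varphi$ by replacing every occurrence of $x$ by $t$ (it is used only where $x\notin V_b(\varphi)$ and no variable that occurs free in $t$ belongs to $V_b(\varphi)$). For distinct $x_1,\dots,x_m$, $H[x_1:\varphi_1,\dots,x_m:\varphi_m]$ means that for $i=1,\dots,m$, with $k_{i-1}=(x_1,\varphi_1)\,\|\,\dots\,\|\,(x_{i-1},\varphi_{i-1})$, one has $\varphi_i\in E(k_{i-1})$ and $\#(k_{i-1},\varphi_i,\sigma)$ is a set for all $\sigma\in\Xi(k_{i-1})$. Finally $$\gamma[x_1:\varphi_1,\dots,x_m:\varphi_m,\psi]=(\forall)(\{\}(x_1:\varphi_1,(\forall)(\{\}(x_2:\varphi_2,\dots(\forall)(\{\}(x_m:\varphi_m,\psi))\dots)))).$$ **Lemma 5.4.** Let $m\ge1$, let $x_1,\dots,x_{m+1}\in V$ be distinct, and let $\varphi_1,\dots,\varphi_{m+1}$ be expressions with $H[x_1:\varphi_1,\dots,x_{m+1}:\varphi_{m+1}]$.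 Put $k=(x_1,\varphi_1)\,\|\,\dots\,\|\,(x_{m+1},\varphi_{m+1})$ and $h=(x_1,\varphi_1)\,\|\,\dots\,\|\,(x_m,\varphi_m)$. Let $\chi\in S(h)$, let $t,t'\in E(h)$ be such that for all $\rho\in\Xi(h)$ $$\#(h,t,\rho)\in\#(h,\varphi_{m+1},\rho)\quad\text{and}\quad\#(h,t',\rho)\in\#(h,\varphi_{m+1},\rho),$$ and let $\varphi\in S(k)$ be such that $V_b(t)\cap V_b(\varphi)=\emptyset$ and $V_b(t')\cap V_b(\varphi)=\emptyset$. Then $\varphi\{x_{m+1}/t\}$ and $\varphi\{x_{m+1}/t'\}$ belong to $S(h)$, the three expressions $$\gamma[x_1:\varphi_1,\dots,x_m:\varphi_m,(\to)(\chi,\varphi\{x_{m+1}/t\})],$$ $$\gamma[x_1:\varphi_1,\dots,x_m:\varphi_m,(\to)(\chi,(=)(t,t'))],$$ $$\gamma[x_1:\varphi_1,\dots,x_m:\varphi_m,(\to)(\chi,\varphi\{x_{m+1}/t'\})]$$ belong to $S(\varepsilon)$, and if $\#(\gamma[x_1:\varphi_1,\dots,x_m:\varphi_m,(\to)(\chi,\varphi\{x_{m+1}/t\})])$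 and $\#(\gamma[x_1:\varphi_1,\dots,x_m:\varphi_m,(\to)(\chi,(=)(t,t'))])$ hold, then $\#(\gamma[x_1:\varphi_1,\dots,x_m:\varphi_m,(\to)(\chi,\varphi\{x_{m+1}/t'\})])$ holds. -/

import Mathlib

universe u v w z

/-! ### The objects that expressions can denote

Truth values, individuals taken from an arbitrary type `A`, and sets of objects: the cumulative
hierarchy over urelements, built as Mathlib builds `ZFSet`. -/

/-- Representatives of objects: a truth value, an individual, or a set given by a family. -/
inductive PreObj (A : Type u) : Type (u + 1)
  | truth (p : Prop) : PreObj A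
  | indiv (a : A) : PreObj A
  | set (ι : Type u) (f : ι → PreObj A) : PreObj A

namespace PreObj

/-- Two representatives denote the same object; sets are compared extensionally. -/
def Equiv {A : Type u} : PreObj A → PreObj A → Prop
  | truth p, truth q => p ↔ q
  | indiv a, indiv b => a = b
  | set _ f, set _ g => (∀ i, ∃ j, Equiv (f i) (g j)) ∧ ∀ j, ∃ i, Equiv (f i) (g j)
  | _, _ => False

theorem Equiv.refl {A : Type u} : ∀ a : PreObj A, Equiv a a
  | truth _ => Iff.rfl
  | indiv _ => rfl
  | set _ f => ⟨fun i => ⟨i, Equiv.refl (f i)⟩, fun i => ⟨i, Equiv.refl (f i)⟩⟩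

theorem Equiv.symm {A : Type u} : ∀ {a b : PreObj A}, Equiv a b → Equiv b a
  | truth _, truth _, h => Iff.symm h
  | indiv _, indiv _, h => Eq.symm h
  | set _ _, set _ _, h =>
    ⟨fun j => let ⟨i, hi⟩ := h.2 j; ⟨i, Equiv.symm hi⟩,
      fun i => let ⟨j, hj⟩ := h.1 i; ⟨j, Equiv.symm hj⟩⟩

theorem Equiv.trans {A : Type u} : ∀ {a b c : PreObj A}, Equiv a b → Equiv b c → Equiv a c
  | truth _, truth _, truth _, h, h' => Iff.trans h h'
  | indiv _, indiv _, indiv _, h, h' => Eq.trans h h'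
  | set _ _, set _ _, set _ _, h, h' =>
    ⟨fun i => let ⟨j, hj⟩ := h.1 i; let ⟨l, hl⟩ := h'.1 j; ⟨l, Equiv.trans hj hl⟩,
      fun l => let ⟨j, hj⟩ := h'.2 l; let ⟨i, hi⟩ := h.2 j; ⟨i, Equiv.trans hi hj⟩⟩

instance setoid (A : Type u) : Setoid (PreObj A) :=
  ⟨Equiv, Equiv.refl, Equiv.symm, Equiv.trans⟩

end PreObj

/-- The objects. -/
def Obj (A : Type u) : Type (u + 1) := Quotient (PreObj.setoid A)

namespace Obj

variable {A : Type u}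

/-- The object denoted by a representative. -/
def mk (a : PreObj A) : Obj A := Quotient.mk (PreObj.setoid A) a

/-- A representative of an object. -/
noncomputable def out (a : Obj A) : PreObj A := Quotient.out (s := PreObj.setoid A) a

theorem mk_out (a : Obj A) : mk a.out = a := Quotient.out_eq (s := PreObj.setoid A) a

theorem mk_eq {a b : PreObj A} : mk a = mk b ↔ PreObj.Equiv a b :=
  ⟨fun h => Quotient.exact h, fun h => Quotient.sound h⟩

/-- The truth value of a condition. -/
def truth (p : Prop) : Obj A := mk (PreObj.truth p)

def IsTrue (a : Obj A) : Prop := a = truth True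

def IsFalse (a : Obj A) : Prop := a = truth False

def IsSet (a : Obj A) : Prop := ∃ (ι : Type u) (f : ι → PreObj A), a = mk (PreObj.set ι f)

/-- `Mem b a` says that `a` is a member of the set `b`. -/
def Mem (b a : Obj A) : Prop :=
  ∃ (ι : Type u) (f : ι → PreObj A) (i : ι), b = mk (PreObj.set ι f) ∧ a = mk (f i)

instance : Membership (Obj A) (Obj A) := ⟨Mem⟩

open Classical in
/-- The set whose members are the elements of `S`, for a small collection `S` of objects (the
empty set if `S` is a proper class). -/
noncomputable def ofSet (S : Set (Obj A)) : Obj A :=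
  if _h : Small.{u} S then
    mk (PreObj.set (Shrink.{u} S) fun i => ((equivShrink S).symm i : Obj A).out)
  else mk (PreObj.set PEmpty PEmpty.elim)

theorem truth_inj {p q : Prop} : (truth p : Obj A) = truth q ↔ (p ↔ q) := mk_eq

theorem mem_mk {ι : Type u} {f : ι → PreObj A} {a : Obj A} :
    a ∈ mk (PreObj.set ι f) ↔ ∃ i, a = mk (f i) := by
  constructor
  · rintro ⟨κ, g, j, hb, rfl⟩
    obtain ⟨i, hi⟩ := (mk_eq.1 hb).2 j
    exact ⟨i, (mk_eq.2 hi).symm⟩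
  · rintro ⟨i, rfl⟩
    exact ⟨ι, f, i, rfl, rfl⟩

theorem mem_ofSet {S : Set (Obj A)} (hS : Small.{u} S) {a : Obj A} : a ∈ ofSet S ↔ a ∈ S := by
  rw [ofSet, dif_pos hS, mem_mk]
  constructor
  · rintro ⟨i, rfl⟩
    rw [mk_out]
    exact Subtype.property _
  · intro ha
    refine ⟨equivShrink S ⟨a, ha⟩, ?_⟩
    rw [mk_out, Equiv.symm_apply_apply]

theorem isSet_ofSet (S : Set (Obj A)) : IsSet (ofSet S) := by
  unfold ofSet
  split_ifs
  exacts [⟨_, _, rfl⟩, ⟨_, _, rfl⟩]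

/-- Sets with the same members are equal. -/
theorem set_ext {a b : Obj A} (ha : IsSet a) (hb : IsSet b) (h : ∀ c, c ∈ a ↔ c ∈ b) : a = b := by
  obtain ⟨ι, f, rfl⟩ := ha
  obtain ⟨κ, g, rfl⟩ := hb
  refine mk_eq.2 ⟨fun i => ?_, fun j => ?_⟩
  · obtain ⟨j, hj⟩ := mem_mk.1 ((h _).1 (mem_mk.2 ⟨i, rfl⟩))
    exact ⟨j, mk_eq.1 hj⟩
  · obtain ⟨i, hi⟩ := mem_mk.1 ((h _).2 (mem_mk.2 ⟨j, rfl⟩))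
    exact ⟨i, mk_eq.1 hi.symm⟩

/-- The members of an object form a small collection. -/
theorem small_members (a : Obj A) : Small.{u} {c | c ∈ a} := by
  by_cases ha : IsSet a
  · obtain ⟨ι, f, rfl⟩ := ha
    have hsm : Small.{u} (Set.range fun i => mk (f i)) := small_range _
    refine @small_subset (Obj A) (Set.range fun i => mk (f i)) _ (fun c hc => ?_) hsm
    obtain ⟨i, hi⟩ := mem_mk.1 hc
    exact ⟨i, hi.symm⟩
  · have hsm : Small.{u} (∅ : Set (Obj A)) := inferInstance
    refine @small_subset (Obj A) ∅ _ ?_ hsm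
    rintro c ⟨ι, f, _, hb, _⟩
    exact ha ⟨ι, f, hb⟩

/-- The ordered pair `(a, b)`. -/
noncomputable def pair (a b : Obj A) : Obj A := ofSet {ofSet {a}, ofSet {a, b}}

/-- The tuple `(a₁, …, aₘ)`; a tuple of length one is its entry. -/
noncomputable def tuple : List (Obj A) → Obj A
  | [] => ofSet ∅
  | [a] => a
  | a :: b :: l => pair a (tuple (b :: l))

/-- `f` is a function with `m` arguments: a single-valued set of ordered pairs whose domain is a
subset of `D × ⋯ × D` (`m` factors) for some set `D`. -/
def IsFunction (m : ℕ) (f : Obj A) : Prop :=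
  IsSet f ∧
    (∃ D : Obj A, IsSet D ∧ ∀ p ∈ f, ∃ (l : List (Obj A)) (b : Obj A),
      l.length = m ∧ (∀ a ∈ l, a ∈ D) ∧ p = pair (tuple l) b) ∧
    ∀ a b b' : Obj A, pair a b ∈ f → pair a b' ∈ f → b = b'

def InDomain (f a : Obj A) : Prop := ∃ b, pair a b ∈ f

open Classical in
/-- The value of the function `f` at `a`. -/
noncomputable def apply (f a : Obj A) : Obj A :=
  if h : ∃ b, pair a b ∈ f then h.choose else ofSet ∅

end Obj

/-! ### Expressions -/

/-- Expressions over variables `V`, operators `F` and constants `C`, as syntax trees. The numbers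
of arguments and of bound variables are positive, hence written `m + 1`. -/
inductive Expr (V : Type v) (F : Type w) (C : Type z) : Type (max v w z)
  /-- a constant -/
  | const (c : C) : Expr V F C
  /-- a variable -/
  | var (x : V) : Expr V F C
  /-- `(φ)(φ₁, …, φₘ)` -/
  | app (φ : Expr V F C) (m : ℕ) (φs : Fin (m + 1) → Expr V F C) : Expr V F C
  /-- `(f)(φ₁, …, φₘ)` for an operator `f` -/
  | op (f : F) (m : ℕ) (φs : Fin (m + 1) → Expr V F C) : Expr V F C
  /-- the set builder `{}(x₁ : φ₁, …, xₘ : φₘ, φ)` -/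
  | setOf (m : ℕ) (xs : Fin (m + 1) → V) (φs : Fin (m + 1) → Expr V F C) (φ : Expr V F C) :
      Expr V F C

namespace Expr

variable {V : Type v} {F : Type w} {C : Type z}

/-- `V_b(t)`: the variables that occur bound in `t`. -/
def boundVars : Expr V F C → Set V
  | const _ => ∅
  | var _ => ∅
  | app φ _ φs => boundVars φ ∪ ⋃ i, boundVars (φs i)
  | op _ _ φs => ⋃ i, boundVars (φs i)
  | setOf _ xs φs φ => Set.range xs ∪ (⋃ i, boundVars (φs i)) ∪ boundVars φ

open Classical in
/-- The substitution `φ{x/t}`. It is used only when `x` and the variables that occur free in `t`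
are not bound in `φ`, so that no renaming is needed. -/
noncomputable def subst (x : V) (t : Expr V F C) : Expr V F C → Expr V F C
  | const c => const c
  | var y => if y = x then t else var y
  | app φ m φs => app (subst x t φ) m fun i => subst x t (φs i)
  | op f m φs => op f m fun i => subst x t (φs i)
  | setOf m xs φs φ => setOf m xs (fun i => subst x t (φs i)) (subst x t φ)

/-- The expression `(f)(φ)`. -/
def op₁ (f : F) (φ : Expr V F C) : Expr V F C := op f 0 ![φ]

/-- The expression `(f)(φ, ψ)`. -/
def op₂ (f : F) (φ ψ : Expr V F C) : Expr V F C := op f 1 ![φ, ψ]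

/-- The expression `{}(x : φ, ψ)`. -/
def setOf₁ (x : V) (φ ψ : Expr V F C) : Expr V F C := setOf 0 ![x] ![φ] ψ

/-- `γ[x₁ : φ₁, …, xₘ : φₘ, ψ] = (∀)({}(x₁ : φ₁, … (∀)({}(xₘ : φₘ, ψ)) … ))`, where `all` is the
universal quantifier symbol. -/
def gamma (all : F) (k : List (V × Expr V F C)) (ψ : Expr V F C) : Expr V F C :=
  k.foldr (fun p χ => op₁ all (setOf₁ p.1 p.2 χ)) ψ

end Expr

/-! ### Languages, contexts, states and meanings -/

/-- A language: the meaning of each constant and, for each operator `f`, the condition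
`A_f(a₁, …, aₙ)` of applicability and the value `P_f(a₁, …, aₙ)`, which matters only where
`A_f` holds. -/
structure Lang (A : Type u) (V : Type v) (F : Type w) (C : Type z) where
  constMeaning : C → Obj A
  Applicable : F → List (Obj A) → Prop
  value : F → List (Obj A) → Obj A

/-- Contexts `(x₁, φ₁) ‖ … ‖ (xₘ, φₘ)`. -/
abbrev Context (V : Type v) (F : Type w) (C : Type z) := List (V × Expr V F C)

/-- States `(x₁, s₁) ‖ … ‖ (xₘ, sₘ)`. -/
abbrev State (A : Type u) (V : Type v) := List (V × Obj A)

open Classical in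
/-- `σ(x)`: the object that the state `σ` attaches to `x`. The variables of a state are distinct. -/
noncomputable def State.val {A : Type u} {V : Type v} (σ : State A V) : V → Obj A :=
  σ.foldl (fun e p => Function.update e p.1 p.2) fun _ => Obj.ofSet ∅

namespace Lang

variable {A : Type u} {V : Type v} {F : Type w} {C : Type z}

/-- `#(k, t, σ)`: the meaning of the expression `t` of a context `k` in a state `σ` on `k`. It
depends on `k` only through `σ`. In the last clause
`σ ‖ (x₁, s₁) ‖ … ‖ (xₘ, sₘ)` runs through the states on `k ‖ (x₁, φ₁) ‖ … ‖ (xₘ, φₘ)` that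
extend `σ`. -/
noncomputable def meaning (L : Lang A V F C) : Expr V F C → State A V → Obj A
  | .const c, _ => L.constMeaning c
  | .var x, σ => σ.val x
  | .app φ _ φs, σ =>
    Obj.apply (L.meaning φ σ) (Obj.tuple (List.ofFn fun i => L.meaning (φs i) σ))
  | .op f _ φs, σ => L.value f (List.ofFn fun i => L.meaning (φs i) σ)
  | .setOf m xs φs φ, σ =>
    Obj.ofSet {a | ∃ s : Fin (m + 1) → Obj A,
      (∀ i, s i ∈ L.meaning (φs i) (σ ++ (List.ofFn fun j => (xs j, s j)).take (i : ℕ))) ∧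
        a = L.meaning φ (σ ++ List.ofFn fun j => (xs j, s j))}

/-- `IsState L k σ` says that `σ ∈ Ξ(k)`. -/
inductive IsState (L : Lang A V F C) : Context V F C → State A V → Prop
  | nil : IsState L [] []
  | snoc {h : Context V F C} {ρ : State A V} (y : V) (φ : Expr V F C) (s : Obj A)
      (hρ : IsState L h ρ) (hs : s ∈ L.meaning φ ρ) :
      IsState L (h ++ [(y, φ)]) (ρ ++ [(y, s)])

/-- For every state `σ` on `k`, the meaning of `φ` is a set. -/
def SetValued (L : Lang A V F C) (k : Context V F C) (φ : Expr V F C) : Prop :=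
  ∀ σ, L.IsState k σ → (L.meaning φ σ).IsSet

/-- `IsExpr L k t` says that `k` is a context and `t` is an expression of the context `k`, that is
`t ∈ E(k)`. The rules are those by which expressions are built in stages, and `IsExpr` is the union
of all stages. -/
inductive IsExpr (L : Lang A V F C) : Context V F C → Expr V F C → Prop
  /-- a constant, in the empty context -/
  | const (c : C) : IsExpr L [] (.const c)
  /-- an expression of `h`, in the context `h ‖ (y, φ)` -/
  | weaken {h : Context V F C} {y : V} {φ t : Expr V F C} (hφ : IsExpr L h φ)
      (hy : y ∉ h.map Prod.fst) (hset : L.SetValued h φ) (ht : IsExpr L h t)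
      (hb : y ∉ t.boundVars) : IsExpr L (h ++ [(y, φ)]) t
  /-- the variable `y`, in the context `h ‖ (y, φ)` -/
  | var {h : Context V F C} {y : V} {φ : Expr V F C} (hφ : IsExpr L h φ)
      (hy : y ∉ h.map Prod.fst) (hset : L.SetValued h φ) : IsExpr L (h ++ [(y, φ)]) (.var y)
  /-- `(φ)(φ₁, …, φₘ)` -/
  | app {k : Context V F C} {φ : Expr V F C} {m : ℕ} {φs : Fin (m + 1) → Expr V F C}
      (hφ : IsExpr L k φ) (hφs : ∀ i, IsExpr L k (φs i))
      (hfun : ∀ σ, L.IsState k σ → (L.meaning φ σ).IsFunction (m + 1) ∧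
        (L.meaning φ σ).InDomain (Obj.tuple (List.ofFn fun i => L.meaning (φs i) σ))) :
      IsExpr L k (.app φ m φs)
  /-- `(f)(φ₁, …, φₘ)` -/
  | op {k : Context V F C} {f : F} {m : ℕ} {φs : Fin (m + 1) → Expr V F C}
      (hφs : ∀ i, IsExpr L k (φs i))
      (happ : ∀ σ, L.IsState k σ → L.Applicable f (List.ofFn fun i => L.meaning (φs i) σ)) :
      IsExpr L k (.op f m φs)
  /-- `{}(x₁ : φ₁, …, xₘ : φₘ, φ)` -/
  | setOf {k : Context V F C} {m : ℕ} {xs : Fin (m + 1) → V} {φs : Fin (m + 1) → Expr V F C}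
      {φ : Expr V F C} (hinj : Function.Injective xs) (hxs : ∀ i, xs i ∉ k.map Prod.fst)
      (hφs : ∀ i : Fin (m + 1),
        IsExpr L (k ++ (List.ofFn fun j => (xs j, φs j)).take (i : ℕ)) (φs i))
      (hset : ∀ i : Fin (m + 1),
        L.SetValued (k ++ (List.ofFn fun j => (xs j, φs j)).take (i : ℕ)) (φs i))
      (hφ : IsExpr L (k ++ List.ofFn fun j => (xs j, φs j)) φ) :
      IsExpr L k (.setOf m xs φs φ)

/-- `IsSentence L k t` says that `t ∈ S(k)`: `t ∈ E(k)` and its meaning is always a truth value. -/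
def IsSentence (L : Lang A V F C) (k : Context V F C) (t : Expr V F C) : Prop :=
  L.IsExpr k t ∧ ∀ σ, L.IsState k σ → (L.meaning t σ).IsTrue ∨ (L.meaning t σ).IsFalse

/-- `#(t)` holds, for `t` an expression of the empty context. -/
def Holds (L : Lang A V F C) (t : Expr V F C) : Prop := (L.meaning t []).IsTrue

/-- `H[x₁ : φ₁, …, xₘ : φₘ]` with distinct `x₁, …, xₘ`, for `k = (x₁, φ₁) ‖ … ‖ (xₘ, φₘ)`. The
context `k[x₁ : φ₁, …, xₘ : φₘ]` is then `k` itself. -/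
def H (L : Lang A V F C) (k : Context V F C) : Prop :=
  (k.map Prod.fst).Nodup ∧
    ∀ i : Fin k.length, L.IsExpr (k.take i) k[i].2 ∧ L.SetValued (k.take i) k[i].2

/-- `f` is the symbol `→` of logical implication. -/
def IsImplication (L : Lang A V F C) (f : F) : Prop :=
  (∀ l, L.Applicable f l ↔
    ∃ a b : Obj A, l = [a, b] ∧ (a.IsTrue ∨ a.IsFalse) ∧ (b.IsTrue ∨ b.IsFalse)) ∧
  ∀ a b, L.Applicable f [a, b] → L.value f [a, b] = Obj.truth (a.IsFalse ∨ b.IsTrue)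

/-- `f` is the universal quantifier `∀`. -/
def IsUniversal (L : Lang A V F C) (f : F) : Prop :=
  (∀ l, l ≠ [] → (L.Applicable f l ↔
    ∃ a : Obj A, l = [a] ∧ a.IsSet ∧ ∀ b ∈ a, b.IsTrue ∨ b.IsFalse)) ∧
  ∀ a, L.Applicable f [a] → L.value f [a] = Obj.truth (∀ b ∈ a, b.IsTrue)

/-- `f` is the symbol `=` of equality. -/
def IsEquality (L : Lang A V F C) (f : F) : Prop :=
  (∀ l, L.Applicable f l ↔ ∃ a b : Obj A, l = [a, b]) ∧
  ∀ a b, L.value f [a, b] = Obj.truth (a = b)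

end Lang

/-! In a state `ρ` on `h`, the meaning of `φ{x/t}` is that of `φ` in `ρ ‖ (x, #(t))`
(`meaning_subst_concat`), and a `γ`-closure holds iff its body is true in every state on `h`
(`IsUniversal.gamma`). So fix `ρ`: either `χ` is false there, or `t` and `t'` have the same meaning,
and then `φ{x/t}` and `φ{x/t'}` both evaluate `φ` in one and the same state.

The work lies in `φ{x/t} ∈ E(h)` (`IsExpr.subst`). Membership in `E` has semantic side conditions,
so the proof is an induction on the derivation of `φ`. Set builders lengthen the context, hence the
induction runs over contexts `h ‖ (x, θ) ‖ l` and lands in `h ‖ l{x/t}`. A side condition there is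
reduced to the given one by inserting `#(t)` into the state (`exists_isState_of_subst`). This is
harmless because meanings depend only on the values of free variables (`meaning_congr`). -/

/-! ### Values of variables in extended states -/

namespace State

variable {A : Type u} {V : Type v}

theorem val_concat (σ : State A V) (y : V) (s : Obj A) [DecidableEq V] :
    State.val (σ ++ [(y, s)]) = Function.update σ.val y s := by
  funext z
  simp only [State.val, List.foldl_append, List.foldl_cons, List.foldl_nil, Function.update_apply]
  split_ifs <;> rfl

theorem val_append_of_notMem (σ τ : State A V) {y : V} (hy : y ∉ τ.map Prod.fst) :
    State.val (σ ++ τ) y = σ.val y := by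
  classical
  induction τ using List.reverseRecOn with
  | nil => simp
  | append_singleton τ p ih =>
    obtain ⟨z, s⟩ := p
    simp only [List.map_append, List.map_cons, List.map_nil, List.mem_append, List.mem_singleton,
      not_or] at hy
    rw [← List.append_assoc, val_concat, Function.update_of_ne hy.2, ih hy.1]

/-- The pairs of `τ` override the earlier ones, so agreement of `σ` and `σ'` matters only at
variables that `τ` leaves alone. This is the situation under a set builder. -/
theorem val_append_congr (σ σ' τ : State A V) {y : V}
    (hy : y ∉ τ.map Prod.fst → σ.val y = σ'.val y) :
    State.val (σ ++ τ) y = State.val (σ' ++ τ) y := by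
  classical
  induction τ using List.reverseRecOn with
  | nil => simpa using hy
  | append_singleton τ p ih =>
    obtain ⟨z, s⟩ := p
    rw [← List.append_assoc, ← List.append_assoc, val_concat, val_concat]
    by_cases hz : y = z
    · subst hz
      simp
    · rw [Function.update_of_ne hz, Function.update_of_ne hz]
      refine ih fun h => hy ?_
      simpa [hz] using h

end State

theorem List.mem_map_fst_take_ofFn {V : Type v} {B : Type w} {n : ℕ} (xs : Fin n → V)
    (b : Fin n → B) (i : ℕ) (y : V) :
    y ∈ ((List.ofFn fun j => (xs j, b j)).take i).map Prod.fst ↔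
      ∃ j : Fin n, (j : ℕ) < i ∧ xs j = y := by
  simp only [List.mem_map, List.mem_take_iff_getElem, Prod.exists, List.getElem_ofFn]
  constructor
  · rintro ⟨a, c, ⟨j, hj, he⟩, rfl⟩
    simp only [List.length_ofFn, lt_min_iff] at hj
    exact ⟨⟨j, hj.2⟩, hj.1, (Prod.ext_iff.1 he).1⟩
  · rintro ⟨j, hj, rfl⟩
    exact ⟨xs j, b j, ⟨j, by simp [hj], rfl⟩, rfl⟩

theorem List.mem_map_fst_ofFn {V : Type v} {B : Type w} {n : ℕ} (xs : Fin n → V)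
    (b : Fin n → B) (y : V) :
    y ∈ (List.ofFn fun j => (xs j, b j)).map Prod.fst ↔ ∃ j : Fin n, xs j = y := by
  simp [List.mem_ofFn]

/-! ### Free variables and substitution, in expressions and contexts -/

namespace Expr

variable {V : Type v} {F : Type w} {C : Type z}

/-- The variables that occur free in an expression. In a set builder, `xⱼ` binds in the later
`φᵢ` and in `φ`. -/
def freeVars : Expr V F C → Set V
  | const _ => ∅
  | var x => {x}
  | app φ _ φs => freeVars φ ∪ ⋃ i, freeVars (φs i)
  | op _ _ φs => ⋃ i, freeVars (φs i)
  | setOf _ xs φs φ =>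
    {y | (∃ i, y ∈ freeVars (φs i) ∧ ∀ j, j < i → xs j ≠ y) ∨
      (y ∈ freeVars φ ∧ ∀ j, xs j ≠ y)}

/-- Absence of free occurrences is not enough: `subst` also enters the scope of a binder of `x` and
replaces `x` there. -/
theorem subst_eq_self (x : V) (t : Expr V F C) (φ : Expr V F C) (hf : x ∉ φ.freeVars)
    (hb : x ∉ φ.boundVars) : subst x t φ = φ := by
  induction φ with
  | const c => rfl
  | var y =>
    have : y ≠ x := fun h => hf (by simp [freeVars, h])
    simp [subst, this]
  | app φ m φs ih ihs =>
    simp only [freeVars, boundVars, Set.mem_union, Set.mem_iUnion, not_or, not_exists] at hf hb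
    simp only [subst, ih hf.1 hb.1]
    congr 1
    exact funext fun i => ihs i (hf.2 i) (hb.2 i)
  | op f m φs ihs =>
    simp only [freeVars, boundVars, Set.mem_iUnion, not_exists] at hf hb
    simp only [subst]
    congr 1
    exact funext fun i => ihs i (hf i) (hb i)
  | setOf m xs φs φ ihs ih =>
    simp only [boundVars, Set.mem_union, Set.mem_iUnion, Set.mem_range, not_or, not_exists] at hb
    simp only [freeVars, Set.mem_ofPred_eq, not_or, not_exists, not_and] at hf
    simp only [subst]
    congr 1
    · exact funext fun i => ihs i (fun h => hf.1 i h fun j _ => hb.1.1 j) (hb.1.2 i)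
    · exact ih (fun h => hf.2 h fun j => hb.1.1 j) hb.2

theorem boundVars_subst (x : V) (t : Expr V F C) (φ : Expr V F C) :
    (subst x t φ).boundVars ⊆ φ.boundVars ∪ t.boundVars := by
  intro y hy
  induction φ with
  | const c => exact Or.inl hy
  | var z =>
    simp only [subst] at hy
    split_ifs at hy
    exacts [Or.inr hy, Or.inl hy]
  | app φ m φs ih ihs =>
    simp only [subst, boundVars, Set.mem_union, Set.mem_iUnion] at hy ih ihs ⊢
    rcases hy with hy | ⟨i, hy⟩
    · exact (ih hy).imp_left Or.inl
    · exact (ihs i hy).imp_left fun h => Or.inr ⟨i, h⟩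
  | op f m φs ihs =>
    simp only [subst, boundVars, Set.mem_union, Set.mem_iUnion] at hy ihs ⊢
    obtain ⟨i, hy⟩ := hy
    exact (ihs i hy).imp_left fun h => ⟨i, h⟩
  | setOf m xs φs φ ihs ih =>
    simp only [subst, boundVars, Set.mem_union, Set.mem_iUnion] at hy ih ihs ⊢
    rcases hy with (hy | ⟨i, hy⟩) | hy
    · exact Or.inl (Or.inl (Or.inl hy))
    · exact (ihs i hy).imp_left fun h => Or.inl (Or.inr ⟨i, h⟩)
    · exact (ih hy).imp_left Or.inr

/-- Contexts and states grow on the right, so induction on them peels off the innermost quantifier.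
-/
theorem gamma_concat (all : F) (k : List (V × Expr V F C)) (x : V) (θ ψ : Expr V F C) :
    gamma all (k ++ [(x, θ)]) ψ = gamma all k (op₁ all (setOf₁ x θ ψ)) := by
  simp [gamma, List.foldr_append]

end Expr

/-- The context `k{x/t}`, in which `t` is substituted for `x` in every expression. -/
noncomputable def Context.subst {V : Type v} {F : Type w} {C : Type z} (x : V) (t : Expr V F C)
    (k : Context V F C) : Context V F C :=
  k.map fun p => (p.1, Expr.subst x t p.2)

namespace Context

variable {V : Type v} {F : Type w} {C : Type z}

theorem map_fst_subst (x : V) (t : Expr V F C) (k : Context V F C) :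
    (k.subst x t).map Prod.fst = k.map Prod.fst := by
  simp [Context.subst]

theorem subst_append (x : V) (t : Expr V F C) (k l : Context V F C) :
    Context.subst x t (k ++ l) = k.subst x t ++ l.subst x t :=
  List.map_append

theorem subst_take_ofFn (x : V) (t : Expr V F C) {n : ℕ} (xs : Fin n → V)
    (φs : Fin n → Expr V F C) (i : ℕ) :
    Context.subst x t ((List.ofFn fun j => (xs j, φs j)).take i) =
      (List.ofFn fun j => (xs j, Expr.subst x t (φs j))).take i := by
  simp only [Context.subst, List.map_take, List.map_ofFn]
  rfl

theorem subst_ofFn (x : V) (t : Expr V F C) {n : ℕ} (xs : Fin n → V) (φs : Fin n → Expr V F C) :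
    Context.subst x t (List.ofFn fun j => (xs j, φs j)) =
      List.ofFn fun j => (xs j, Expr.subst x t (φs j)) := by
  simp only [Context.subst, List.map_ofFn]
  rfl

end Context

namespace Lang

variable {A : Type u} {V : Type v} {F : Type w} {C : Type z} {L : Lang A V F C}

/-! ### Meanings -/

/-- In a set builder both states are extended by the same pairs; a variable free in a part either
gets its value from these or is free in the whole. The two states may have different lengths. -/
theorem meaning_congr (t : Expr V F C) (σ σ' : State A V)
    (hσ : ∀ y ∈ t.freeVars, σ.val y = σ'.val y) : L.meaning t σ = L.meaning t σ' := by
  induction t generalizing σ σ' with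
  | const c => rfl
  | var x => exact hσ x rfl
  | app φ m φs ih ihs =>
    simp only [meaning]
    rw [ih σ σ' fun y hy => hσ y (Or.inl hy)]
    congr 3
    exact funext fun i => ihs i σ σ' fun y hy => hσ y (Or.inr (Set.mem_iUnion.2 ⟨i, hy⟩))
  | op f m φs ihs =>
    simp only [meaning]
    congr 2
    exact funext fun i => ihs i σ σ' fun y hy => hσ y (Set.mem_iUnion.2 ⟨i, hy⟩)
  | setOf m xs φs φ ihs ih =>
    simp only [meaning]
    congr 1
    ext a
    refine exists_congr fun s => and_congr (forall_congr' fun i => ?_) ?_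
    · rw [ihs i _ (σ' ++ (List.ofFn fun j => (xs j, s j)).take (i : ℕ))]
      intro y hy
      refine State.val_append_congr _ _ _ fun h => hσ y (Or.inl ⟨i, hy, fun j hj he => h ?_⟩)
      exact (List.mem_map_fst_take_ofFn _ _ _ _).2 ⟨j, hj, he⟩
    · rw [ih _ (σ' ++ List.ofFn fun j => (xs j, s j))]
      intro y hy
      refine State.val_append_congr _ _ _ fun h => hσ y (Or.inr ⟨hy, fun j he => h ?_⟩)
      exact (List.mem_map_fst_ofFn _ _ _).2 ⟨j, he⟩

theorem meaning_append (t : Expr V F C) (σ τ : State A V)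
    (h : ∀ y ∈ t.freeVars, y ∉ τ.map Prod.fst) : L.meaning t (σ ++ τ) = L.meaning t σ :=
  meaning_congr t _ _ fun y hy => State.val_append_of_notMem σ τ (h y hy)

/-- The meaning of `φ{x/t}` in `σ` is that of `φ` in the state `σ'` that differs from `σ` only by
attaching to `x` the meaning of `t`. -/
theorem meaning_subst (x : V) (t φ : Expr V F C) (hx : x ∉ φ.boundVars)
    (hd : ∀ y ∈ t.freeVars, y ∉ φ.boundVars) (σ σ' : State A V)
    (hσx : σ'.val x = L.meaning t σ) (hσ : ∀ y, y ≠ x → σ'.val y = σ.val y) :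
    L.meaning (Expr.subst x t φ) σ = L.meaning φ σ' := by
  induction φ generalizing σ σ' with
  | const c => rfl
  | var y =>
    by_cases h : y = x
    · simp [Expr.subst, h, meaning, hσx]
    · simp [Expr.subst, h, meaning, hσ y h]
  | app φ m φs ih ihs =>
    simp only [Expr.boundVars, Set.mem_union, Set.mem_iUnion, not_or, not_exists] at hx hd
    simp only [Expr.subst, meaning]
    rw [ih hx.1 (fun y hy => (hd y hy).1) σ σ' hσx hσ]
    congr 3
    exact funext fun i => ihs i (hx.2 i) (fun y hy => (hd y hy).2 i) σ σ' hσx hσ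
  | op f m φs ihs =>
    simp only [Expr.boundVars, Set.mem_iUnion, not_exists] at hx hd
    simp only [Expr.subst, meaning]
    congr 2
    exact funext fun i => ihs i (hx i) (fun y hy => hd y hy i) σ σ' hσx hσ
  | setOf m xs φs φ ihs ih =>
    simp only [Expr.boundVars, Set.mem_union, Set.mem_iUnion, Set.mem_range, not_or,
      not_exists] at hx hd
    simp only [Expr.subst, meaning]
    -- The relation between `σ` and `σ'` survives extension by the bound variables: none of them is
    -- `x`, and none is free in `t`.
    have key (τ : State A V) (hτ : ∀ y ∈ τ.map Prod.fst, ∃ j, xs j = y) :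
        State.val (σ' ++ τ) x = L.meaning t (σ ++ τ) ∧
          ∀ y, y ≠ x → State.val (σ' ++ τ) y = State.val (σ ++ τ) y := by
      refine ⟨?_, fun y hy => State.val_append_congr _ _ _ fun _ => hσ y hy⟩
      rw [State.val_append_of_notMem, meaning_append, hσx]
      · intro y hy hy'
        obtain ⟨j, hj⟩ := hτ y hy'
        exact (hd y hy).1.1 j hj
      · intro hy'
        obtain ⟨j, hj⟩ := hτ x hy'
        exact hx.1.1 j hj
    congr 1
    ext a
    refine exists_congr fun s => and_congr (forall_congr' fun i => ?_) ?_
    · obtain ⟨h₁, h₂⟩ := key ((List.ofFn fun j => (xs j, s j)).take (i : ℕ)) fun y hy => by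
        obtain ⟨j, _, hj⟩ := (List.mem_map_fst_take_ofFn _ _ _ _).1 hy
        exact ⟨j, hj⟩
      rw [ihs i (hx.1.2 i) (fun y hy => (hd y hy).1.2 i) _ _ h₁ h₂]
    · obtain ⟨h₁, h₂⟩ := key (List.ofFn fun j => (xs j, s j)) fun y hy =>
        (List.mem_map_fst_ofFn _ _ _).1 hy
      rw [ih hx.2 (fun y hy => (hd y hy).2) _ _ h₁ h₂]

/-! ### States -/

theorem isState_concat {h : Context V F C} {y : V} {φ : Expr V F C} {σ : State A V} :
    L.IsState (h ++ [(y, φ)]) σ ↔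
      ∃ ρ s, σ = ρ ++ [(y, s)] ∧ L.IsState h ρ ∧ s ∈ L.meaning φ ρ := by
  constructor
  · generalize hk : h ++ [(y, φ)] = k
    rintro (_ | ⟨y', φ', s, hρ, hs⟩)
    · simp at hk
    · obtain ⟨rfl, h₂⟩ := List.append_inj' hk rfl
      simp only [List.cons.injEq, Prod.mk.injEq, and_true] at h₂
      obtain ⟨rfl, rfl⟩ := h₂
      exact ⟨_, s, rfl, hρ, hs⟩
  · rintro ⟨ρ, s, rfl, hρ, hs⟩
    exact .snoc y φ s hρ hs

theorem isState_nil {σ : State A V} : L.IsState [] σ ↔ σ = [] := by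
  constructor
  · generalize hk : ([] : Context V F C) = k
    rintro (_ | ⟨y', φ', s, hρ, hs⟩)
    · rfl
    · simp at hk
  · rintro rfl
    exact .nil

/-! ### Variables of expressions of a context -/

theorem IsExpr.freeVars_subset {k : Context V F C} {t : Expr V F C} (ht : L.IsExpr k t) :
    ∀ y ∈ t.freeVars, y ∈ k.map Prod.fst := by
  induction ht with
  | const c => exact fun y hy => hy.elim
  | weaken _ _ _ _ _ _ ih =>
    intro y hy
    rw [List.map_append, List.mem_append]
    exact Or.inl (ih y hy)
  | var _ _ _ _ =>
    intro y hy
    simp only [Expr.freeVars, Set.mem_singleton_iff] at hy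
    simp [hy]
  | app _ _ _ ih ihs =>
    intro y hy
    simp only [Expr.freeVars, Set.mem_union, Set.mem_iUnion] at hy
    rcases hy with hy | ⟨i, hy⟩
    exacts [ih y hy, ihs i y hy]
  | op _ _ ihs =>
    intro y hy
    simp only [Expr.freeVars, Set.mem_iUnion] at hy
    obtain ⟨i, hy⟩ := hy
    exact ihs i y hy
  | setOf _ _ _ _ _ ihs ih =>
    rintro y (⟨i, hy, h⟩ | ⟨hy, h⟩)
    · have := ihs i y hy
      rw [List.map_append, List.mem_append, List.mem_map_fst_take_ofFn] at this
      rcases this with h' | ⟨j, hj, he⟩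
      exacts [h', absurd he (h j hj)]
    · have := ih y hy
      rw [List.map_append, List.mem_append, List.mem_map_fst_ofFn] at this
      rcases this with h' | ⟨j, he⟩
      exacts [h', absurd he (h j)]

/-- Weakening refuses a variable that is already bound. With `freeVars_subset` this excludes
capture: the free variables of `t ∈ E(h)` lie in `dom(h)`, which the bound variables of `φ ∈ E(h ‖
(x, θ) ‖ l)` avoid. -/
theorem IsExpr.boundVars_disjoint {k : Context V F C} {t : Expr V F C} (ht : L.IsExpr k t) :
    ∀ y ∈ t.boundVars, y ∉ k.map Prod.fst := by
  induction ht with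
  | const c => exact fun y hy => hy.elim
  | @weaken h z φ t _ _ _ _ hb _ ih =>
    intro y hy
    have hne : y ≠ z := fun h => hb (h ▸ hy)
    simpa [hne] using ih y hy
  | var _ _ _ _ => exact fun y hy => hy.elim
  | app _ _ _ ih ihs =>
    intro y hy
    simp only [Expr.boundVars, Set.mem_union, Set.mem_iUnion] at hy
    rcases hy with hy | ⟨i, hy⟩
    exacts [ih y hy, ihs i y hy]
  | op _ _ ihs =>
    intro y hy
    simp only [Expr.boundVars, Set.mem_iUnion] at hy
    obtain ⟨i, hy⟩ := hy
    exact ihs i y hy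
  | setOf _ hxs _ _ _ ihs ih =>
    intro y hy hk
    simp only [Expr.boundVars, Set.mem_union, Set.mem_iUnion, Set.mem_range] at hy
    rcases hy with (⟨i, rfl⟩ | ⟨i, hy⟩) | hy
    · exact hxs i hk
    · exact ihs i y hy (by rw [List.map_append]; exact List.mem_append_left _ hk)
    · exact ih y hy (by rw [List.map_append]; exact List.mem_append_left _ hk)

/-! ### Substitution -/

section Substitution

variable {h : Context V F C} {x : V} {θ t : Expr V F C}

/-- The condition on the part `l` of the context `h ‖ (x, θ) ‖ l` under which `t ∈ E(h)` can be
substituted for `x`. -/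
def Substitutable (h : Context V F C) (x : V) (t : Expr V F C) (l : Context V F C) : Prop :=
  ∀ p ∈ l, (p.1 ∉ t.boundVars ∧ p.1 ≠ x ∧ p.1 ∉ h.map Prod.fst) ∧
    ∀ y ∈ p.2.boundVars, y ∉ t.boundVars ∧ y ≠ x ∧ y ∉ h.map Prod.fst

/-- A state on `h ‖ l{x/t}` becomes a state on `h ‖ (x, θ) ‖ l` by inserting the meaning of `t`. -/
theorem exists_isState_of_subst (ht : L.IsExpr h t)
    (htθ : ∀ ρ, L.IsState h ρ → L.meaning t ρ ∈ L.meaning θ ρ)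
    (l : Context V F C) (hl : Substitutable h x t l) (σ : State A V)
    (hσ : L.IsState (h ++ l.subst x t) σ) :
    ∃ σ', L.IsState (h ++ [(x, θ)] ++ l) σ' ∧
      ∀ φ : Expr V F C, (∀ y ∈ φ.boundVars, y ≠ x ∧ y ∉ h.map Prod.fst) →
        L.meaning (Expr.subst x t φ) σ = L.meaning φ σ' := by
  -- By `meaning_subst` it is enough to control the values of `σ'`.
  suffices ∃ σ', L.IsState (h ++ [(x, θ)] ++ l) σ' ∧ σ'.val x = L.meaning t σ ∧
      ∀ y, y ≠ x → σ'.val y = σ.val y by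
    obtain ⟨σ', h₁, h₂, h₃⟩ := this
    refine ⟨σ', h₁, fun φ hφ => meaning_subst x t φ (fun hx => (hφ x hx).1 rfl) ?_ σ σ' h₂ h₃⟩
    exact fun y hy hy' => (hφ y hy').2 (ht.freeVars_subset y hy)
  classical
  induction l using List.reverseRecOn generalizing σ with
  | nil =>
    simp only [Context.subst, List.map_nil, List.append_nil] at hσ ⊢
    refine ⟨σ ++ [(x, L.meaning t σ)], .snoc x θ _ hσ (htθ σ hσ), ?_, fun y hy => ?_⟩
    · simp [State.val_concat]
    · simp [State.val_concat, hy]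
  | append_singleton l p ih =>
    obtain ⟨y, φ⟩ := p
    rw [Context.subst_append, ← List.append_assoc] at hσ
    obtain ⟨ρ, s, rfl, hρ, hs⟩ := isState_concat.1 hσ
    obtain ⟨ρ', h₁, h₂, h₃⟩ := ih (fun p hp => hl p (List.mem_append_left _ hp)) ρ hρ
    obtain ⟨⟨-, hyx, hyh⟩, hφ⟩ := hl (y, φ) (by simp)
    refine ⟨ρ' ++ [(y, s)], ?_, ?_, fun z hz => ?_⟩
    · rw [← List.append_assoc]
      refine .snoc y φ s h₁ ?_
      rwa [meaning_subst x t φ (fun hx => (hφ x hx).2.1 rfl)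
        (fun y hy hy' => (hφ y hy').2.2 (ht.freeVars_subset y hy)) ρ ρ' h₂ h₃] at hs
    -- The new variable `y` is not in `dom(h)`, hence not free in `t`, whose meaning stays the same.
    · rw [State.val_append_of_notMem _ _ (by simpa using hyx.symm), h₂, meaning_append]
      intro z hz hz'
      simp only [List.map_cons, List.map_nil, List.mem_singleton] at hz'
      exact hyh (hz' ▸ ht.freeVars_subset z hz)
    · exact State.val_append_congr _ _ _ fun _ => h₃ z hz

theorem SetValued.subst (ht : L.IsExpr h t)
    (htθ : ∀ ρ, L.IsState h ρ → L.meaning t ρ ∈ L.meaning θ ρ) {l : Context V F C}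
    (hl : Substitutable h x t l) {φ : Expr V F C}
    (hφ : ∀ y ∈ φ.boundVars, y ≠ x ∧ y ∉ h.map Prod.fst)
    (hset : L.SetValued (h ++ [(x, θ)] ++ l) φ) :
    L.SetValued (h ++ l.subst x t) (Expr.subst x t φ) := by
  intro σ hσ
  obtain ⟨σ', hσ', hm⟩ := exists_isState_of_subst ht htθ l hl σ hσ
  rw [hm φ hφ]
  exact hset σ' hσ'

theorem IsExpr.boundVars_avoid {k l : Context V F C} {φ : Expr V F C} (hφ : L.IsExpr k φ)
    (hk : k = h ++ [(x, θ)] ++ l) : ∀ y ∈ φ.boundVars, y ≠ x ∧ y ∉ h.map Prod.fst := by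
  intro y hy
  have := hφ.boundVars_disjoint y hy
  simp only [hk, List.map_append, List.map_cons, List.map_nil, List.mem_append,
    List.mem_singleton, not_or] at this
  exact ⟨this.1.2, this.1.1⟩

/-- Substitution of `t ∈ E(h)` for `x` turns expressions of `h ‖ (x, θ) ‖ l` into expressions of
`h ‖ l{x/t}`. -/
theorem IsExpr.subst (ht : L.IsExpr h t)
    (htθ : ∀ ρ, L.IsState h ρ → L.meaning t ρ ∈ L.meaning θ ρ)
    {k : Context V F C} {φ : Expr V F C} (hφ : L.IsExpr k φ) :
    ∀ l, k = h ++ [(x, θ)] ++ l → Substitutable h x t l →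
      (∀ y ∈ φ.boundVars, y ∉ t.boundVars) → L.IsExpr (h ++ l.subst x t) (Expr.subst x t φ) := by
  induction hφ with
  | const c =>
    intro l hk
    simp at hk
  | @weaken h' y φ t₀ hφ hy hset ht₀ hyb ih ih₀ =>
    intro l hk hl hb
    -- If `l` is empty, the weakening added `(x, θ)` itself and the substitution changes nothing;
    -- otherwise it added the last pair of `l` and commutes with the substitution.
    rcases List.eq_nil_or_concat l with rfl | ⟨l, p, rfl⟩
    · rw [List.append_nil] at hk
      obtain ⟨rfl, h₂⟩ := List.append_inj' hk rfl
      simp only [List.cons.injEq, Prod.mk.injEq, and_true] at h₂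
      obtain ⟨rfl, rfl⟩ := h₂
      rw [Expr.subst_eq_self _ _ _ (fun hf => hy (ht₀.freeVars_subset _ hf)) hyb]
      simpa [Context.subst] using ht₀
    · simp only [List.concat_eq_append] at hk hl ⊢
      rw [← List.append_assoc] at hk
      obtain ⟨rfl, h₂⟩ := List.append_inj' hk rfl
      simp only [List.cons.injEq, and_true] at h₂
      subst h₂
      have hl' : Substitutable h x t l := fun p hp => hl p (List.mem_append_left _ hp)
      obtain ⟨⟨hyt, hyx, hyh⟩, hφt⟩ := hl (y, φ) (by simp)
      rw [Context.subst_append, ← List.append_assoc]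
      refine .weaken (ih l rfl hl' fun y hy => (hφt y hy).1) ?_ ?_ (ih₀ l rfl hl' hb) ?_
      · rw [List.map_append, Context.map_fst_subst]
        simp only [List.map_append, List.mem_append, not_or] at hy ⊢
        exact ⟨hy.1.1, hy.2⟩
      · exact hset.subst ht htθ hl' fun y hy => (hφt y hy).2
      -- The substituted expression may contain `t`, so weakening by `y` also requires `y ∉ V_b(t)`.
      -- This is why `V_b(t)` and `V_b(φ)` have to be disjoint.
      · exact fun hm => (Expr.boundVars_subst x t t₀ hm).elim hyb hyt
  | @var h' y φ hφ hy hset ih =>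
    intro l hk hl hb
    rcases List.eq_nil_or_concat l with rfl | ⟨l, p, rfl⟩
    · rw [List.append_nil] at hk
      obtain ⟨rfl, h₂⟩ := List.append_inj' hk rfl
      simp only [List.cons.injEq, Prod.mk.injEq, and_true] at h₂
      obtain ⟨rfl, rfl⟩ := h₂
      simpa [Context.subst, Expr.subst] using ht
    · simp only [List.concat_eq_append] at hk hl ⊢
      rw [← List.append_assoc] at hk
      obtain ⟨rfl, h₂⟩ := List.append_inj' hk rfl
      simp only [List.cons.injEq, and_true] at h₂
      subst h₂
      have hl' : Substitutable h x t l := fun p hp => hl p (List.mem_append_left _ hp)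
      obtain ⟨⟨hyt, hyx, hyh⟩, hφt⟩ := hl (y, φ) (by simp)
      rw [Context.subst_append, ← List.append_assoc, Expr.subst, if_neg hyx]
      refine .var (ih l rfl hl' fun y hy => (hφt y hy).1) ?_ ?_
      · rw [List.map_append, Context.map_fst_subst]
        simp only [List.map_append, List.mem_append, not_or] at hy ⊢
        exact ⟨hy.1.1, hy.2⟩
      · exact hset.subst ht htθ hl' fun y hy => (hφt y hy).2
  | @app k φ m φs hφ hφs hfun ih ihs =>
    rintro l rfl hl hb
    simp only [Expr.boundVars, Set.mem_union, Set.mem_iUnion] at hb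
    refine .app (ih l rfl hl fun y hy => hb y (Or.inl hy))
      (fun i => ihs i l rfl hl fun y hy => hb y (Or.inr ⟨i, hy⟩)) fun σ hσ => ?_
    obtain ⟨σ', hσ', hm⟩ := exists_isState_of_subst ht htθ l hl σ hσ
    simp only [hm φ (hφ.boundVars_avoid rfl), fun i => hm (φs i) ((hφs i).boundVars_avoid rfl)]
    exact hfun σ' hσ'
  | @op k f m φs hφs happ ihs =>
    rintro l rfl hl hb
    simp only [Expr.boundVars, Set.mem_iUnion] at hb
    refine .op (fun i => ihs i l rfl hl fun y hy => hb y ⟨i, hy⟩) fun σ hσ => ?_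
    obtain ⟨σ', hσ', hm⟩ := exists_isState_of_subst ht htθ l hl σ hσ
    simp only [fun i => hm (φs i) ((hφs i).boundVars_avoid rfl)]
    exact happ σ' hσ'
  | @setOf k m xs φs φ hinj hxs hφs hset hφ ihs ih =>
    rintro l rfl hl hb
    simp only [Expr.boundVars, Set.mem_union, Set.mem_iUnion, Set.mem_range] at hb
    have hav (i : Fin (m + 1)) := (hφs i).boundVars_avoid (List.append_assoc _ _ _)
    -- The pairs of the set builder join `l`, so the induction hypotheses apply to its parts.
    have hofFn : Substitutable h x t (l ++ List.ofFn fun j => (xs j, φs j)) := by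
      intro p hp
      rcases List.mem_append.1 hp with hp | hp
      · exact hl p hp
      · obtain ⟨j, rfl⟩ := (List.mem_ofFn' _ _).1 hp
        refine ⟨⟨hb _ (Or.inl (Or.inl ⟨j, rfl⟩)), ?_⟩,
          fun y hy => ⟨hb y (Or.inl (Or.inr ⟨j, hy⟩)), hav j y hy⟩⟩
        have := hxs j
        simp only [List.map_append, List.map_cons, List.map_nil, List.mem_append,
          List.mem_singleton, not_or] at this
        exact ⟨this.1.2, this.1.1⟩
    have htake (i : ℕ) :
        Substitutable h x t (l ++ (List.ofFn fun j => (xs j, φs j)).take i) := by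
      refine fun p hp => hofFn p (List.mem_append.2 ?_)
      exact (List.mem_append.1 hp).imp_right List.mem_of_mem_take
    rw [Expr.subst]
    refine .setOf hinj (fun i => ?_) (fun i => ?_) (fun i => ?_) ?_
    · have := hxs i
      rw [List.map_append, Context.map_fst_subst]
      simp only [List.map_append, List.mem_append, not_or] at this ⊢
      exact ⟨this.1.1, this.2⟩
    · rw [← Context.subst_take_ofFn, List.append_assoc, ← Context.subst_append]
      exact ihs i _ (List.append_assoc _ _ _) (htake i) fun y hy =>
        hb y (Or.inl (Or.inr ⟨i, hy⟩))
    · rw [← Context.subst_take_ofFn, List.append_assoc, ← Context.subst_append]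
      refine SetValued.subst ht htθ (htake i) (hav i) ?_
      rw [← List.append_assoc]
      exact hset i
    · rw [← Context.subst_ofFn, List.append_assoc, ← Context.subst_append]
      exact ih _ (List.append_assoc _ _ _) hofFn fun y hy => hb y (Or.inr hy)

theorem IsExpr.meaning_subst_concat (ht : L.IsExpr h t) {φ : Expr V F C}
    (hφ : L.IsExpr (h ++ [(x, θ)]) φ) (ρ : State A V) :
    L.meaning (Expr.subst x t φ) ρ = L.meaning φ (ρ ++ [(x, L.meaning t ρ)]) := by
  classical
  have hav := hφ.boundVars_avoid (List.append_nil _).symm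
  refine meaning_subst x t φ (fun hx => (hav x hx).1 rfl)
    (fun y hy hy' => (hav y hy').2 (ht.freeVars_subset y hy)) ρ _ ?_ fun y hy => ?_
  · simp [State.val_concat]
  · simp [State.val_concat, hy]

theorem IsSentence.subst (ht : L.IsExpr h t)
    (htθ : ∀ ρ, L.IsState h ρ → L.meaning t ρ ∈ L.meaning θ ρ) {φ : Expr V F C}
    (hφ : L.IsSentence (h ++ [(x, θ)]) φ) (hb : t.boundVars ∩ φ.boundVars = ∅) :
    L.IsSentence h (Expr.subst x t φ) := by
  refine ⟨?_, fun ρ hρ => ?_⟩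
  · have := IsExpr.subst ht htθ hφ.1 [] (List.append_nil _).symm (fun p hp => by simp at hp)
      fun y hy hy' => (Set.mem_empty_iff_false y).1 (hb ▸ ⟨hy', hy⟩)
    simpa [Context.subst] using this
  · rw [ht.meaning_subst_concat hφ.1]
    exact hφ.2 _ (.snoc x θ _ hρ (htθ ρ hρ))

end Substitution

/-! ### Logical operators -/

theorem _root_.Obj.isTrue_truth {p : Prop} : (Obj.truth p : Obj A).IsTrue ↔ p := by
  simp [Obj.IsTrue, Obj.truth_inj]

theorem _root_.Obj.isTrue_or_isFalse_truth (p : Prop) :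
    (Obj.truth p : Obj A).IsTrue ∨ (Obj.truth p : Obj A).IsFalse := by
  by_cases h : p <;> simp [Obj.IsTrue, Obj.IsFalse, Obj.truth_inj, h]

section Operators

variable {imp all eq : F} {k : Context V F C} {x : V} {φ ψ : Expr V F C}

theorem meaning_op₁ (f : F) (φ : Expr V F C) (σ : State A V) :
    L.meaning (Expr.op₁ f φ) σ = L.value f [L.meaning φ σ] := by
  simp [Expr.op₁, meaning]

theorem meaning_op₂ (f : F) (φ ψ : Expr V F C) (σ : State A V) :
    L.meaning (Expr.op₂ f φ ψ) σ = L.value f [L.meaning φ σ, L.meaning ψ σ] := by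
  simp [Expr.op₂, meaning]

theorem IsExpr.op₁ {f : F} (hφ : L.IsExpr k φ)
    (happ : ∀ σ, L.IsState k σ → L.Applicable f [L.meaning φ σ]) :
    L.IsExpr k (Expr.op₁ f φ) :=
  .op (fun i => by fin_cases i; exact hφ) fun σ hσ => by simpa using happ σ hσ

theorem IsExpr.op₂ {f : F} (hφ : L.IsExpr k φ) (hψ : L.IsExpr k ψ)
    (happ : ∀ σ, L.IsState k σ → L.Applicable f [L.meaning φ σ, L.meaning ψ σ]) :
    L.IsExpr k (Expr.op₂ f φ ψ) :=
  .op (fun i => by fin_cases i; exacts [hφ, hψ]) fun σ hσ => by simpa using happ σ hσ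

/-- The value of `→` is prescribed only on truth values, hence the need for sentences and for a
state on `k`. -/
theorem IsImplication.meaning_eq (himp : L.IsImplication imp) (hφ : L.IsSentence k φ)
    (hψ : L.IsSentence k ψ) {σ : State A V} (hσ : L.IsState k σ) :
    L.meaning (Expr.op₂ imp φ ψ) σ =
      Obj.truth ((L.meaning φ σ).IsFalse ∨ (L.meaning ψ σ).IsTrue) := by
  rw [meaning_op₂]
  exact himp.2 _ _ ((himp.1 _).2 ⟨_, _, rfl, hφ.2 σ hσ, hψ.2 σ hσ⟩)

theorem IsImplication.isSentence (himp : L.IsImplication imp) (hφ : L.IsSentence k φ)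
    (hψ : L.IsSentence k ψ) : L.IsSentence k (Expr.op₂ imp φ ψ) := by
  refine ⟨hφ.1.op₂ hψ.1 fun σ hσ => (himp.1 _).2 ⟨_, _, rfl, hφ.2 σ hσ, hψ.2 σ hσ⟩,
    fun σ hσ => ?_⟩
  rw [himp.meaning_eq hφ hψ hσ]
  exact Obj.isTrue_or_isFalse_truth _

theorem IsEquality.meaning_eq (heq : L.IsEquality eq) (φ ψ : Expr V F C) (σ : State A V) :
    L.meaning (Expr.op₂ eq φ ψ) σ = Obj.truth (L.meaning φ σ = L.meaning ψ σ) := by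
  rw [meaning_op₂]
  exact heq.2 _ _

theorem IsEquality.isSentence (heq : L.IsEquality eq) (hφ : L.IsExpr k φ) (hψ : L.IsExpr k ψ) :
    L.IsSentence k (Expr.op₂ eq φ ψ) := by
  refine ⟨hφ.op₂ hψ fun σ _ => (heq.1 _).2 ⟨_, _, rfl⟩, fun σ _ => ?_⟩
  rw [heq.meaning_eq]
  exact Obj.isTrue_or_isFalse_truth _

theorem isSet_meaning_setOf₁ (x : V) (φ ψ : Expr V F C) (σ : State A V) :
    (L.meaning (Expr.setOf₁ x φ ψ) σ).IsSet := by
  simp only [Expr.setOf₁, meaning]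
  exact Obj.isSet_ofSet _

theorem mem_meaning_setOf₁ (x : V) (φ ψ : Expr V F C) (σ : State A V) (a : Obj A) :
    a ∈ L.meaning (Expr.setOf₁ x φ ψ) σ ↔
      ∃ s ∈ L.meaning φ σ, a = L.meaning ψ (σ ++ [(x, s)]) := by
  have hset : {a : Obj A | ∃ s : Fin 1 → Obj A,
      (∀ i : Fin 1, s i ∈ L.meaning (![φ] i)
        (σ ++ (List.ofFn fun j => ((![x] : Fin 1 → V) j, s j)).take (i : ℕ))) ∧
        a = L.meaning ψ (σ ++ List.ofFn fun j => ((![x] : Fin 1 → V) j, s j))} =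
      (fun s => L.meaning ψ (σ ++ [(x, s)])) '' {s | s ∈ L.meaning φ σ} := by
    ext b
    simp only [Set.mem_ofPred_eq, Set.mem_image]
    constructor
    · rintro ⟨s, hs, rfl⟩
      exact ⟨s 0, by simpa using hs 0, by simp⟩
    · rintro ⟨s, hs, rfl⟩
      exact ⟨fun _ => s, fun i => by fin_cases i; simpa using hs, by simp⟩
  -- Replacement: the image of the members of an object is small, so `Obj.ofSet` does not fall back
  -- to the empty set.
  have hsmall : Small.{u} ((fun s => L.meaning ψ (σ ++ [(x, s)])) '' {s | s ∈ L.meaning φ σ}) :=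
    have := Obj.small_members (L.meaning φ σ)
    small_image _ _
  simp only [Expr.setOf₁, meaning]
  rw [hset, Obj.mem_ofSet hsmall]
  simp only [Set.mem_image, Set.mem_ofPred_eq, eq_comm]

theorem IsExpr.setOf₁ (hφ : L.IsExpr k φ) (hset : L.SetValued k φ)
    (hx : x ∉ k.map Prod.fst) (hψ : L.IsExpr (k ++ [(x, φ)]) ψ) :
    L.IsExpr k (Expr.setOf₁ x φ ψ) := by
  refine .setOf (fun i j _ => Subsingleton.elim (α := Fin 1) i j) (fun i => ?_) (fun i => ?_) (fun i => ?_) ?_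
  · fin_cases i; exact hx
  · fin_cases i; simpa using hφ
  · fin_cases i; simpa using hset
  · simpa using hψ

theorem IsUniversal.applicable (hall : L.IsUniversal all)
    (hψ : L.IsSentence (k ++ [(x, φ)]) ψ) {σ : State A V} (hσ : L.IsState k σ) :
    L.Applicable all [L.meaning (Expr.setOf₁ x φ ψ) σ] := by
  refine (hall.1 _ (by simp)).2 ⟨_, rfl, isSet_meaning_setOf₁ _ _ _ _, fun b hb => ?_⟩
  obtain ⟨s, hs, rfl⟩ := (mem_meaning_setOf₁ _ _ _ _ _).1 hb
  exact hψ.2 _ (.snoc x φ s hσ hs)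

theorem IsUniversal.meaning_eq (hall : L.IsUniversal all)
    (hψ : L.IsSentence (k ++ [(x, φ)]) ψ) {σ : State A V} (hσ : L.IsState k σ) :
    L.meaning (Expr.op₁ all (Expr.setOf₁ x φ ψ)) σ =
      Obj.truth (∀ s ∈ L.meaning φ σ, (L.meaning ψ (σ ++ [(x, s)])).IsTrue) := by
  rw [meaning_op₁, hall.2 _ (hall.applicable hψ hσ), Obj.truth_inj]
  simp only [mem_meaning_setOf₁]
  exact ⟨fun H s hs => H _ ⟨s, hs, rfl⟩, by rintro H _ ⟨s, hs, rfl⟩; exact H s hs⟩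

theorem IsUniversal.isSentence (hall : L.IsUniversal all)
    (hψ : L.IsSentence (k ++ [(x, φ)]) ψ) (hφ : L.IsExpr k φ) (hset : L.SetValued k φ)
    (hx : x ∉ k.map Prod.fst) : L.IsSentence k (Expr.op₁ all (Expr.setOf₁ x φ ψ)) := by
  refine ⟨(hφ.setOf₁ hset hx hψ.1).op₁ fun σ hσ => hall.applicable hψ hσ, fun σ hσ => ?_⟩
  rw [hall.meaning_eq hψ hσ]
  exact Obj.isTrue_or_isFalse_truth _

end Operators

/-! ### Universal closure over a context -/

theorem h_concat {k : Context V F C} {x : V} {θ : Expr V F C} (hH : L.H (k ++ [(x, θ)])) :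
    L.H k ∧ x ∉ k.map Prod.fst ∧ L.IsExpr k θ ∧ L.SetValued k θ := by
  obtain ⟨hnd, hE⟩ := hH
  rw [List.map_append, List.nodup_append] at hnd
  refine ⟨⟨hnd.1, fun i => ?_⟩, fun hx => hnd.2.2 _ hx x (by simp) rfl, ?_⟩
  · have := hE ⟨i, by rw [List.length_append]; omega⟩
    simpa [List.take_append_of_le_length i.2.le, List.getElem_append_left i.2] using this
  · simpa using hE ⟨k.length, by simp⟩

/-- The universal closure of a sentence is a sentence, which holds iff the given one is true in
every state. -/
theorem IsUniversal.gamma {all : F} (hall : L.IsUniversal all) {k : Context V F C} (hH : L.H k)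
    {ψ : Expr V F C} (hψ : L.IsSentence k ψ) :
    L.IsSentence [] (Expr.gamma all k ψ) ∧
      (L.Holds (Expr.gamma all k ψ) ↔ ∀ σ, L.IsState k σ → (L.meaning ψ σ).IsTrue) := by
  induction k using List.reverseRecOn generalizing ψ with
  | nil => exact ⟨hψ, by simp [isState_nil, Holds, Expr.gamma]⟩
  | append_singleton k p ih =>
    obtain ⟨x, θ⟩ := p
    obtain ⟨hH', hx, hθ, hset⟩ := h_concat hH
    -- The induction hypothesis is applied to the sentence already quantified over the last
    -- variable.
    obtain ⟨hs, hiff⟩ := ih hH' (hall.isSentence hψ hθ hset hx)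
    rw [Expr.gamma_concat]
    refine ⟨hs, hiff.trans ⟨fun H σ hσ => ?_, fun H σ hσ => ?_⟩⟩
    · obtain ⟨ρ, s, rfl, hρ, hmem⟩ := isState_concat.1 hσ
      have := H ρ hρ
      rw [hall.meaning_eq hψ hρ, Obj.isTrue_truth] at this
      exact this s hmem
    · rw [hall.meaning_eq hψ hσ, Obj.isTrue_truth]
      exact fun s hs => H _ (.snoc x θ s hσ hs)

end Lang

/-! ### Substitution of equals under a hypothesis -/

theorem lemma5p4 {A : Type u} {V : Type v} {F : Type w} {C : Type z}
    (L : Lang A V F C) (imp all eq : F)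
    (himp : L.IsImplication imp) (hall : L.IsUniversal all) (heq : L.IsEquality eq)
    (h : Context V F C) (hm : h ≠ []) (x : V) (θ : Expr V F C)
    (k : Context V F C) (hk : k = h ++ [(x, θ)]) (hH : L.H k)
    (χ : Expr V F C) (hχ : L.IsSentence h χ)
    (t : Expr V F C) (ht : L.IsExpr h t)
    (htθ : ∀ ρ, L.IsState h ρ → L.meaning t ρ ∈ L.meaning θ ρ)
    (t' : Expr V F C) (ht' : L.IsExpr h t')
    (htθ' : ∀ ρ, L.IsState h ρ → L.meaning t' ρ ∈ L.meaning θ ρ)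
    (φ : Expr V F C) (hφ : L.IsSentence k φ)
    (hb : t.boundVars ∩ φ.boundVars = ∅) (hb' : t'.boundVars ∩ φ.boundVars = ∅) :
    L.IsSentence h (Expr.subst x t φ) ∧
    L.IsSentence h (Expr.subst x t' φ) ∧
    L.IsSentence [] (Expr.gamma all h (Expr.op₂ imp χ (Expr.subst x t φ))) ∧
    L.IsSentence [] (Expr.gamma all h (Expr.op₂ imp χ (Expr.op₂ eq t t'))) ∧
    L.IsSentence [] (Expr.gamma all h (Expr.op₂ imp χ (Expr.subst x t' φ))) ∧
    (L.Holds (Expr.gamma all h (Expr.op₂ imp χ (Expr.subst x t φ))) →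
      L.Holds (Expr.gamma all h (Expr.op₂ imp χ (Expr.op₂ eq t t'))) →
      L.Holds (Expr.gamma all h (Expr.op₂ imp χ (Expr.subst x t' φ)))) := by
  subst hk
  have hHh := (Lang.h_concat hH).1
  have hs := hφ.subst ht htθ hb
  have hs' := hφ.subst ht' htθ' hb'
  have he := heq.isSentence ht ht'
  obtain ⟨g₁, e₁⟩ := hall.gamma hHh (himp.isSentence hχ hs)
  obtain ⟨g₂, e₂⟩ := hall.gamma hHh (himp.isSentence hχ he)
  obtain ⟨g₃, e₃⟩ := hall.gamma hHh (himp.isSentence hχ hs')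
  refine ⟨hs, hs', g₁, g₂, g₃, ?_⟩
  rw [e₁, e₂, e₃]
  intro H₁ H₂ ρ hρ
  have h₁ := H₁ ρ hρ
  have h₂ := H₂ ρ hρ
  rw [himp.meaning_eq hχ hs hρ, Obj.isTrue_truth] at h₁
  rw [himp.meaning_eq hχ he hρ, Obj.isTrue_truth, heq.meaning_eq, Obj.isTrue_truth] at h₂
  rw [himp.meaning_eq hχ hs' hρ, Obj.isTrue_truth]
  rcases h₁ with h₁ | h₁
  · exact Or.inl h₁
  refine h₂.imp_right fun h₂ => ?_
  -- Both substituted sentences become `φ` evaluated in `ρ` extended at `x`, and `h₂` identifies the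
  -- two extensions.
  rw [ht.meaning_subst_concat hφ.1] at h₁
  rwa [ht'.meaning_subst_concat hφ.1, ← h₂]
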